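/- Let $G$ and $H$ be (discrete) groups and let $\alpha\colon H\to\mathrm{Aut}(G)$ be a group homomorphism. Write $C^*(\Gamma)$ for the full group $C^*$-algebra of a discrete group $\Gamma$ and $i_\Gamma\colon\Gamma\to C^*(\Gamma)$ for its universal unitary representation. Then there exists a (unital) $*$-homomorphism $\iota\colon C^*(G)\to C^*(G\rtimes_\alpha H)$ such that $\iota(i_G(g))=i_{G\rtimes_\alpha H}(g,e_H)$ for every $g\in G$. If $G$ is amenable, then $\iota$ is injective, and $\iota$ is a $*$-isomorphism of $C^*(G)$ onto the $C^*$-subalgebra $\overline{\mathrm{span}}\{i_{G\rtimes_\alpha H}(g,e_H):g\in G\}$ of $C^*(G\rtimes_\alpha H)$. -/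

import Mathlib

open scoped ENNReal

universe u

noncomputable section

/-- A unitary representation of the (discrete) group `G` on a nonzero complex Hilbert space: a
group homomorphism from `G` into the unitary group of `B(space)`. The Hilbert spaces are taken in
the universe of `G`. This loses nothing: a unitary representation on any Hilbert space is a direct
sum of cyclic ones, and a cyclic unitary representation of `G` is unitarily equivalent to one on a
Hilbert space in the universe of `G` (a completion of a quotient of `ℂ[G]`). -/
structure UnitaryRep (G : Type u) [Group G] : Type (u + 1) where
  space : Type u
  [normedAddCommGroup : NormedAddCommGroup space]
  [innerProductSpace : InnerProductSpace ℂ space]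
  [completeSpace : CompleteSpace space]
  [nontrivial : Nontrivial space]
  rep : G →* unitary (space →L[ℂ] space)

attribute [instance] UnitaryRep.normedAddCommGroup UnitaryRep.innerProductSpace
  UnitaryRep.completeSpace UnitaryRep.nontrivial

/-- The C⋆-algebra of all uniformly bounded families `(T_π)_π` of operators `T_π ∈ B(H_π)`, where
`π` runs over the unitary representations of `G`, with pointwise operations and supremum norm. -/
abbrev UnitaryRep.BoundedFamilies (G : Type u) [Group G] : Type (u + 1) :=
  lp (fun π : UnitaryRep G => π.space →L[ℂ] π.space) ∞

instance (G : Type u) [Group G] : CStarAlgebra (UnitaryRep.BoundedFamilies G) where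

/-- The family `(π(g))_π` of operators that `g : G` defines in all unitary representations. -/
def UnitaryRep.family {G : Type u} [Group G] (g : G) : UnitaryRep.BoundedFamilies G :=
  ⟨fun π => (π.rep g : π.space →L[ℂ] π.space),
    memℓp_infty ⟨1, by
      rintro _ ⟨π, rfl⟩
      exact (CStarRing.norm_coe_unitary (π.rep g)).le⟩⟩

/-- The (full) group C⋆-algebra `C⋆(G)` of the discrete group `G`, realised as the closed
⋆-subalgebra generated by the elements `(π(g))_π`, `g ∈ G`. In other words it is the completion of
the group algebra `ℂ[G]` in the norm `‖∑ c_g g‖ = sup_π ‖∑ c_g π(g)‖`, the supremum being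
over all unitary representations `π` of `G`. -/
def groupCStar (G : Type u) [Group G] : StarSubalgebra ℂ (UnitaryRep.BoundedFamilies G) :=
  (StarAlgebra.adjoin ℂ
    (Set.range (UnitaryRep.family : G → UnitaryRep.BoundedFamilies G))).topologicalClosure

/-- The group C⋆-algebra as a type. -/
def GroupCStarAlgebra (G : Type u) [Group G] : Type (u + 1) := groupCStar G

instance (G : Type u) [Group G] : CStarAlgebra (GroupCStarAlgebra G) :=
  StarSubalgebra.cstarAlgebra (groupCStar G)
    (h_closed := StarSubalgebra.isClosed_topologicalClosure _)

theorem UnitaryRep.family_mem_groupCStar {G : Type u} [Group G] (g : G) :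
    UnitaryRep.family g ∈ groupCStar G := by
  have h : (UnitaryRep.family g : UnitaryRep.BoundedFamilies G) ∈
      StarAlgebra.adjoin ℂ (Set.range (UnitaryRep.family : G → UnitaryRep.BoundedFamilies G)) :=
    StarAlgebra.subset_adjoin ℂ _ (Set.mem_range_self g)
  exact StarSubalgebra.le_topologicalClosure _ h

/-- The element of `C⋆(G)` given by the family `(π(g))_π`. -/
def GroupCStarAlgebra.of {G : Type u} [Group G] (g : G) : GroupCStarAlgebra G :=
  (⟨UnitaryRep.family g, UnitaryRep.family_mem_groupCStar g⟩ : groupCStar G)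

theorem GroupCStarAlgebra.of_mem_unitary {G : Type u} [Group G] (g : G) :
    (GroupCStarAlgebra.of g : GroupCStarAlgebra G) ∈ unitary (GroupCStarAlgebra G) :=
  Unitary.mem_iff.mpr
    ⟨Subtype.ext (lp.ext (funext fun π => Unitary.coe_star_mul_self (π.rep g))),
      Subtype.ext (lp.ext (funext fun π => Unitary.coe_mul_star_self (π.rep g)))⟩

/-- The universal unitary representation `i_G` of `G` in `C⋆(G)`, `i_G(g) = (π(g))_π`. -/
def iG (G : Type u) [Group G] : G →* unitary (GroupCStarAlgebra G) where
  toFun g := ⟨GroupCStarAlgebra.of g, GroupCStarAlgebra.of_mem_unitary g⟩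
  map_one' := Subtype.ext (Subtype.ext (lp.ext (funext fun π =>
    congrArg (Subtype.val : unitary (π.space →L[ℂ] π.space) → _) (map_one π.rep))))
  map_mul' g h := Subtype.ext (Subtype.ext (lp.ext (funext fun π =>
    congrArg (Subtype.val : unitary (π.space →L[ℂ] π.space) → _) (map_mul π.rep g h))))

/-- Amenability of a discrete group: there is a left-invariant finitely additive probability
measure defined on all subsets of the group. -/
def IsAmenableGroup (G : Type*) [Group G] : Prop :=
  ∃ μ : Set G → ℝ, (∀ s, 0 ≤ μ s) ∧ μ Set.univ = 1 ∧
    (∀ s t, Disjoint s t → μ (s ∪ t) = μ s + μ t) ∧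
    ∀ (g : G) (s : Set G), μ ((fun x => g * x) '' s) = μ s

end

/-!
The homomorphism `ι : C⋆(G) → C⋆(G ⋊[α] H)` exists because every unitary representation of
`G ⋊[α] H` restricts to one of `G`, so that the norm of `C⋆(G)` dominates that of `C⋆(G ⋊[α] H)` on
linear combinations of elements of `G`. The Hilbert spaces that define the norm of `C⋆(G)` lie in the
universe of `G`, while those of the restricted representations may lie in a larger one. Norms of
operators are suprema over vectors, and a vector only sees the closed cyclic subspace that it
generates; this subspace has an orthonormal basis indexed by a type in the universe of `G`
(`exists_unitaryRep_isometry`), which gives the bound `GroupCStarAlgebra.norm_linearCombination_le`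
and with it `GroupCStarAlgebra.exists_map`.

Injectivity comes from induced representations. For a representation `π` of `G` on `K`, the
representation `inducedHom α π` of `G ⋊[α] H` on `ℓ²(H, K)`, when restricted to `G`, contains `π` as
the coordinate at `1 : H`. If `ι a = 0`, then `a` acts as zero in the restricted induced
representation, hence in `π`; since `π` is arbitrary, `a = 0`
(`injective_of_map_iG_semidirectProduct`).

An injective ⋆-homomorphism between C⋆-algebras is isometric, so the range of `ι` is closed. As the
elements `i_G(g)` span a dense subspace of `C⋆(G)`, the range is the closed span of their images.
-/

noncomputable section

open Set

/-! ### Small Hilbert spaces -/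

/-- Every point of the closure is the limit of a sequence in `s`, so the closure embeds into
`ℕ → s`. -/
theorem small_closure_of_small {X : Type*} [TopologicalSpace X] [FrechetUrysohnSpace X]
    [T2Space X] (s : Set X) [Small.{u} s] : Small.{u} (closure s) := by
  have h : ∀ x : closure s, ∃ y : ℕ → s,
      Filter.Tendsto (fun n => (y n : X)) Filter.atTop (nhds x) := by
    rintro ⟨x, hx⟩
    obtain ⟨y, hy, hyx⟩ := mem_closure_iff_seq_limit.mp hx
    exact ⟨fun n => ⟨y n, hy n⟩, hyx⟩
  choose y hy using h
  refine small_of_injective (f := y) fun a b hab => Subtype.ext ?_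
  exact tendsto_nhds_unique (hy a) (hab ▸ hy b)

/-- A Hilbert space with few enough elements for the universe `u` is isometric to an `ℓ²`-space that
lives in `u`, indexed by a copy of a Hilbert basis. -/
theorem exists_linearIsometryEquiv_lp_of_small (K : Type*) [NormedAddCommGroup K]
    [InnerProductSpace ℂ K] [CompleteSpace K] [Small.{u} K] :
    ∃ ι : Type u, Nonempty (lp (fun _ : ι => ℂ) 2 ≃ₗᵢ[ℂ] K) := by
  obtain ⟨w, b, _⟩ := exists_hilbertBasis ℂ K
  let e := (equivShrink w).symm
  let b' : HilbertBasis (Shrink.{u} w) ℂ K :=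
    HilbertBasis.mk (v := b ∘ e) (b.orthonormal.comp e e.injective) (by
      rw [e.surjective.range_comp]
      exact b.dense_span.ge)
  exact ⟨Shrink.{u} w, ⟨b'.repr.symm⟩⟩

/-! ### Unitary representations on invariant subspaces -/

theorem MonoidHom.mem_unitary_of_norm_map {Γ K : Type*} [Group Γ] [NormedAddCommGroup K]
    [InnerProductSpace ℂ K] [CompleteSpace K] (f : Γ →* (K →L[ℂ] K))
    (hf : ∀ g v, ‖f g v‖ = ‖v‖) (g : Γ) : f g ∈ unitary (K →L[ℂ] K) :=
  ((Group.isUnit g).map f).mem_unitary_of_star_mul_self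
    ((f g).norm_map_iff_adjoint_comp_self.mp (hf g))

theorem norm_unitary_apply {K : Type*} [NormedAddCommGroup K]
    [InnerProductSpace ℂ K] [CompleteSpace K] (U : unitary (K →L[ℂ] K)) (v : K) :
    ‖(U : K →L[ℂ] K) v‖ = ‖v‖ :=
  ContinuousLinearMap.norm_map_of_mem_unitary U.2 v

/-- The restriction of a unitary representation `σ` to an invariant subspace, which is given as the
range of a linear isometry `J : L → K`; the group acts on `L` by `J⋆ σ(g) J`. -/
def compressionHom {Γ K L : Type*} [Group Γ] [NormedAddCommGroup K]
    [InnerProductSpace ℂ K] [CompleteSpace K] [NormedAddCommGroup L]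
    [InnerProductSpace ℂ L] [CompleteSpace L] (σ : Γ →* unitary (K →L[ℂ] K)) (J : L →ₗᵢ[ℂ] K)
    (hJ : ∀ g v, (σ g : K →L[ℂ] K) (J v) ∈ range J) : Γ →* unitary (L →L[ℂ] L) :=
  have key : ∀ w, J.toContinuousLinearMap.adjoint (J w) = w := fun w =>
    congr($(J.adjoint_comp_self) w)
  let f : Γ →* (L →L[ℂ] L) :=
    { toFun g := J.toContinuousLinearMap.adjoint ∘L (σ g : K →L[ℂ] K) ∘L J.toContinuousLinearMap
      map_one' := by ext v; simp [key]
      map_mul' g h := by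
        ext v
        obtain ⟨w, hw⟩ := hJ h v
        simp [← hw, key] }
  f.codRestrict (unitary (L →L[ℂ] L)) (f.mem_unitary_of_norm_map fun g v => by
    obtain ⟨w, hw⟩ := hJ g v
    have : f g v = w := by simp [f, ← hw, key]
    rw [this, ← J.norm_map, hw, norm_unitary_apply, J.norm_map])

/-- `J` intertwines the restricted representation with `σ`. -/
theorem compressionHom_apply {Γ K L : Type*} [Group Γ] [NormedAddCommGroup K]
    [InnerProductSpace ℂ K] [CompleteSpace K] [NormedAddCommGroup L]
    [InnerProductSpace ℂ L] [CompleteSpace L] (σ : Γ →* unitary (K →L[ℂ] K)) (J : L →ₗᵢ[ℂ] K)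
    (hJ : ∀ g v, (σ g : K →L[ℂ] K) (J v) ∈ range J) (g : Γ) (v : L) :
    J ((compressionHom σ J hJ g : L →L[ℂ] L) v) = (σ g : K →L[ℂ] K) (J v) := by
  obtain ⟨w, hw⟩ := hJ g v
  have key : J.toContinuousLinearMap.adjoint (J w) = w := congr($(J.adjoint_comp_self) w)
  change J (J.toContinuousLinearMap.adjoint ((σ g : K →L[ℂ] K) (J v))) = _
  rw [← hw, key]

/-! ### C⋆-algebras topologically spanned by a group of unitaries -/

theorem ContinuousLinearMap.map_linearCombination {G B E : Type*} [CStarAlgebra B]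
    [NormedAddCommGroup E] [NormedSpace ℂ E] (T : B →L[ℂ] E) (v : G → B) (c : G →₀ ℂ) :
    T (Finsupp.linearCombination ℂ v c) = Finsupp.linearCombination ℂ (fun g => T (v g)) c :=
  Finsupp.apply_linearCombination ℂ T.toLinearMap v c

section DenseSpan

variable {G A B E : Type*} [Group G] [CStarAlgebra A] [CStarAlgebra B] [NormedAddCommGroup E]
  [NormedSpace ℂ E] {i : G →* unitary B}

theorem ContinuousLinearMap.ext_of_dense_span_unitary
    (hi : Dense (Submodule.span ℂ (range fun g => (i g : B)) : Set B))
    {S T : B →L[ℂ] E} (h : ∀ g, S (i g) = T (i g)) : S = T :=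
  ContinuousLinearMap.ext_on hi (by rintro _ ⟨g, rfl⟩; exact h g)

/-- Two continuous linear maps out of `B`, one of them factoring through a ⋆-homomorphism `φ`, agree
as soon as they agree on the group. -/
theorem StarAlgHom.apply_eq_of_dense_span_unitary
    (hi : Dense (Submodule.span ℂ (range fun g => (i g : B)) : Set B))
    (φ : B →⋆ₐ[ℂ] A) (T : A →L[ℂ] E) (S : B →L[ℂ] E) (h : ∀ g, T (φ (i g)) = S (i g)) (b : B) :
    T (φ b) = S b := by
  let φL : B →L[ℂ] A := ⟨φ.toAlgHom.toLinearMap,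
    (NonUnitalStarAlgHom.instContinuousLinearMapClassComplex (F := B →⋆ₐ[ℂ] A)).map_continuous φ⟩
  have : T ∘L φL = S := ContinuousLinearMap.ext_of_dense_span_unitary hi h
  exact congr($this b)

/-- An injective ⋆-homomorphism of C⋆-algebras is isometric, so its range is closed and equals the
closed span of the images of topological generators. -/
theorem StarAlgHom.coe_range_eq_closure_span
    (hi : Dense (Submodule.span ℂ (range fun g => (i g : B)) : Set B))
    (φ : B →⋆ₐ[ℂ] A) (hφ : Function.Injective φ) :
    (φ.range : Set A) = closure (Submodule.span ℂ (range fun g => φ (i g)) : Set A) := by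
  have hspan : (Submodule.span ℂ (range fun g => φ (i g)) : Set A) =
      φ '' (Submodule.span ℂ (range fun g => (i g : B)) : Set B) := by
    have := Submodule.map_span φ.toAlgHom.toLinearMap (range fun g => (i g : B))
    rw [← range_comp] at this
    exact (congrArg SetLike.coe this).symm
  have hiso : Isometry φ := AddMonoidHomClass.isometry_of_norm φ (NonUnitalStarAlgHom.norm_map φ hφ)
  rw [hspan, hiso.isClosedEmbedding.closure_image_eq, hi.closure_eq, image_univ]
  rfl

/-- A unitary representation extends to a ⋆-homomorphism once the resulting linear extension is
contractive on linear combinations of group elements. -/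
theorem StarAlgHom.exists_of_norm_linearCombination_le
    (hi : Dense (Submodule.span ℂ (range fun g => (i g : B)) : Set B))
    (σ : G →* unitary A)
    (h : ∀ c : G →₀ ℂ, ‖Finsupp.linearCombination ℂ (fun g => (σ g : A)) c‖ ≤
      ‖Finsupp.linearCombination ℂ (fun g => (i g : B)) c‖) :
    ∃ φ : B →⋆ₐ[ℂ] A, ∀ g, φ (i g) = σ g := by
  let I : (G →₀ ℂ) →ₗ[ℂ] B := Finsupp.linearCombination ℂ fun g => (i g : B)
  have hI : DenseRange I := by
    rwa [DenseRange, ← LinearMap.coe_range, Finsupp.range_linearCombination]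
  let T : B →L[ℂ] A :=
    (Finsupp.linearCombination ℂ fun g => (σ g : A)).extendOfNorm I
  have hT (g : G) : T (i g) = σ g := by
    have := LinearMap.extendOfNorm_eq (f := Finsupp.linearCombination ℂ (fun g => (σ g : A)))
      hI ⟨1, fun c => (h c).trans_eq (one_mul _).symm⟩ (Finsupp.single g 1)
    have hIg : I (Finsupp.single g 1) = i g := by simp [I]
    rwa [hIg, Finsupp.linearCombination_single, one_smul] at this
  have hT1 : T 1 = 1 := by simpa using hT 1
  have hmul1 (g : G) (b : B) :
      T ((i g : B) * b) = T (i g) * T b := by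
    have : T ∘L ContinuousLinearMap.mul ℂ _ (i g : B) =
        ContinuousLinearMap.mul ℂ A (T (i g)) ∘L T :=
      ContinuousLinearMap.ext_of_dense_span_unitary hi fun k => by
        have := hT (g * k)
        rw [map_mul, map_mul] at this
        change T ((i g : B) * (i k : B)) = T _ * T _
        rw [hT, hT]
        exact this
    exact congr($this b)
  have hmul (a b : B) : T (a * b) = T a * T b := by
    have : T ∘L (ContinuousLinearMap.mul ℂ _).flip b =
        (ContinuousLinearMap.mul ℂ A).flip (T b) ∘L T :=
      ContinuousLinearMap.ext_of_dense_span_unitary hi fun g => hmul1 g b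
    exact congr($this a)
  have hstar (a : B) : T (star a) = star (T a) := by
    refine hi.induction (P := fun a => T (star a) = star (T a)) ?_
      (isClosed_eq (T.continuous.comp continuous_star) (continuous_star.comp T.continuous)) a
    intro x hx
    induction hx using Submodule.span_induction with
    | mem x hx =>
      obtain ⟨g, rfl⟩ := hx
      have := hT g⁻¹
      rw [map_inv, map_inv] at this
      rw [hT]
      exact this
    | zero => simp
    | add x y _ _ hx hy => simp [hx, hy]
    | smul c x _ hx => simp [hx]
  exact ⟨{ toFun := T
           map_one' := hT1
           map_mul' := hmul
           map_zero' := map_zero T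
           map_add' := map_add T
           commutes' := fun r => by
             rw [Algebra.algebraMap_eq_smul_one, Algebra.algebraMap_eq_smul_one, map_smul, hT1]
           map_star' := hstar }, hT⟩

end DenseSpan

/-! ### Cyclic subrepresentations in the universe of the group -/

/-- Every nonzero vector of a unitary representation, on a Hilbert space in any universe, lies in a
subrepresentation that is equivalent to one in the universe of `G`: the closed cyclic subspace of
the vector is small, since it is the closure of an image of `G →₀ ℂ`. -/
theorem exists_unitaryRep_isometry {G : Type u} [Group G] {K : Type*} [NormedAddCommGroup K]
    [InnerProductSpace ℂ K] [CompleteSpace K] (σ : G →* unitary (K →L[ℂ] K)) (v : K) (hv : v ≠ 0) :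
    ∃ (π : UnitaryRep G) (J : π.space →ₗᵢ[ℂ] K), v ∈ range J ∧
      ∀ g w, J ((π.rep g : π.space →L[ℂ] π.space) w) = (σ g : K →L[ℂ] K) (J w) := by
  let D : Submodule ℂ K := Submodule.span ℂ (range fun g => (σ g : K →L[ℂ] K) v)
  let C := D.topologicalClosure
  have : Small.{u} D := by
    have : (D : Set K) = range (Finsupp.linearCombination ℂ fun g => (σ g : K →L[ℂ] K) v) := by
      rw [← LinearMap.coe_range, Finsupp.range_linearCombination]
    change Small.{u} (D : Set K)
    rw [this]
    infer_instance
  have : Small.{u} C := small_closure_of_small (D : Set K)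
  have hvC : v ∈ C := D.le_topologicalClosure (Submodule.subset_span ⟨1, by simp⟩)
  have hC : ∀ g, ∀ w ∈ C, (σ g : K →L[ℂ] K) w ∈ C := by
    intro g w hw
    refine map_mem_closure (σ g : K →L[ℂ] K).continuous hw fun x hx => ?_
    change x ∈ D.comap ((σ g : K →L[ℂ] K) : K →ₗ[ℂ] K)
    refine Submodule.span_le.mpr ?_ hx
    rintro _ ⟨h, rfl⟩
    exact Submodule.subset_span ⟨g * h, by simp⟩
  have : CompleteSpace C := D.isClosed_topologicalClosure.completeSpace_coe
  obtain ⟨ι, ⟨e⟩⟩ := exists_linearIsometryEquiv_lp_of_small.{u} C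
  let J := C.subtypeₗᵢ.comp e.toLinearIsometry
  have hJ : range J = C := by
    ext x
    constructor
    · rintro ⟨w, rfl⟩
      exact (e w).2
    · exact fun hx => ⟨e.symm ⟨x, hx⟩, by simp [J]⟩
  have hvJ : v ∈ range J := hJ ▸ hvC
  have : Nontrivial (lp (fun _ : ι => ℂ) 2) := by
    obtain ⟨w, hw⟩ := hvJ
    exact ⟨w, 0, fun h => hv (by rw [← hw, h, map_zero])⟩
  have hJσ : ∀ g w, (σ g : K →L[ℂ] K) (J w) ∈ range J := fun g w => by
    have hw : J w ∈ (C : Set K) := hJ ▸ mem_range_self w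
    rw [hJ]
    exact hC g _ hw
  exact ⟨⟨_, compressionHom σ J hJσ⟩, J, hvJ, compressionHom_apply σ J hJσ⟩

/-! ### Functoriality of the group C⋆-algebra -/

namespace GroupCStarAlgebra

/-- The representation of `C⋆(G)` on the Hilbert space of `π`, as a continuous linear map: evaluation
of a bounded family at the coordinate `π`. -/
def evalCLM {G : Type u} [Group G] (π : UnitaryRep G) :
    GroupCStarAlgebra G →L[ℂ] (π.space →L[ℂ] π.space) :=
  (lp.evalCLM ℂ (fun π : UnitaryRep G => π.space →L[ℂ] π.space) ∞ π).comp
    (groupCStar G).toSubalgebra.toSubmodule.subtypeL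

@[simp]
theorem evalCLM_iG {G : Type u} [Group G] (π : UnitaryRep G) (g : G) :
    evalCLM π (iG G g : GroupCStarAlgebra G) = π.rep g := rfl

theorem ext_evalCLM {G : Type u} [Group G] {a b : GroupCStarAlgebra G}
    (h : ∀ π, evalCLM π a = evalCLM π b) : a = b :=
  Subtype.ext (lp.ext (funext h))

theorem norm_evalCLM_apply_le {G : Type u} [Group G] (π : UnitaryRep G)
    (a : GroupCStarAlgebra G) : ‖evalCLM π a‖ ≤ ‖a‖ :=
  lp.norm_apply_le_norm (E := fun π : UnitaryRep G => π.space →L[ℂ] π.space)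
    ENNReal.top_ne_zero (Subtype.val a : UnitaryRep.BoundedFamilies G) π

theorem norm_le_of_forall_evalCLM_le {G : Type u} [Group G] {a : GroupCStarAlgebra G} {C : ℝ}
    (hC : 0 ≤ C) (h : ∀ π, ‖evalCLM π a‖ ≤ C) : ‖a‖ ≤ C :=
  lp.norm_le_of_forall_le (E := fun π : UnitaryRep G => π.space →L[ℂ] π.space)
    (f := (Subtype.val a : UnitaryRep.BoundedFamilies G)) hC h

/-- The linear span of the group is already a ⋆-subalgebra. -/
theorem adjoin_le_span_family (G : Type u) [Group G] :
    (StarAlgebra.adjoin ℂ (range (UnitaryRep.family : G → UnitaryRep.BoundedFamilies G)) :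
      Set (UnitaryRep.BoundedFamilies G)) ⊆
    Submodule.span ℂ (range (UnitaryRep.family : G → UnitaryRep.BoundedFamilies G)) := by
  have hone : (UnitaryRep.family 1 : UnitaryRep.BoundedFamilies G) = 1 :=
    congrArg (fun x : unitary (GroupCStarAlgebra G) => Subtype.val (x : GroupCStarAlgebra G))
      (map_one (iG G))
  have hmul (g h : G) : (UnitaryRep.family g * UnitaryRep.family h :
      UnitaryRep.BoundedFamilies G) = UnitaryRep.family (g * h) :=
    (congrArg (fun x : unitary (GroupCStarAlgebra G) => Subtype.val (x : GroupCStarAlgebra G))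
      (map_mul (iG G) g h)).symm
  have hstar (g : G) : star (UnitaryRep.family g : UnitaryRep.BoundedFamilies G) =
      UnitaryRep.family g⁻¹ :=
    (congrArg (fun x : unitary (GroupCStarAlgebra G) => Subtype.val (x : GroupCStarAlgebra G))
      (map_inv (iG G) g)).symm
  intro x hx
  induction hx using StarAlgebra.adjoin_induction with
  | mem x h => exact Submodule.subset_span h
  | algebraMap r =>
    rw [Algebra.algebraMap_eq_smul_one, ← hone]
    exact Submodule.smul_mem _ _ (Submodule.subset_span ⟨1, rfl⟩)
  | add x y _ _ hx hy => exact add_mem hx hy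
  | mul x y _ _ hx hy =>
    have := Submodule.mul_mem_mul hx hy
    rw [Submodule.span_mul_span] at this
    refine Submodule.span_mono ?_ this
    rintro _ ⟨_, ⟨g, rfl⟩, _, ⟨h, rfl⟩, rfl⟩
    exact ⟨g * h, (hmul g h).symm⟩
  | star x hm hx =>
    clear hm
    induction hx using Submodule.span_induction with
    | mem x h =>
      obtain ⟨g, rfl⟩ := h
      exact Submodule.subset_span ⟨g⁻¹, (hstar g).symm⟩
    | zero => simp
    | add x y _ _ hx hy => rw [star_add]; exact add_mem hx hy
    | smul c x _ hx => rw [star_smul]; exact Submodule.smul_mem _ _ hx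

theorem dense_span_range_iG (G : Type u) [Group G] :
    Dense (Submodule.span ℂ (range fun g => (iG G g : GroupCStarAlgebra G)) :
      Set (GroupCStarAlgebra G)) := by
  have hind : Topology.IsInducing
      (Subtype.val : GroupCStarAlgebra G → UnitaryRep.BoundedFamilies G) := ⟨rfl⟩
  have hspan : (Submodule.span ℂ (range (UnitaryRep.family : G → UnitaryRep.BoundedFamilies G)) :
      Set (UnitaryRep.BoundedFamilies G)) = Subtype.val '' (Submodule.span ℂ
        (range fun g => (iG G g : GroupCStarAlgebra G)) : Set (GroupCStarAlgebra G)) := by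
    have := Submodule.map_span (groupCStar G).toSubalgebra.toSubmodule.subtype
      (range fun g => (iG G g : GroupCStarAlgebra G))
    refine Eq.trans ?_ (congrArg SetLike.coe this).symm
    exact congrArg (fun s => SetLike.coe (Submodule.span ℂ s)) (range_comp Subtype.val
      fun g => (iG G g : GroupCStarAlgebra G))
  intro a
  refine hind.closure_eq_preimage_closure_image _ ▸ ?_
  change a.1 ∈ closure _
  rw [← hspan]
  exact closure_mono (adjoin_le_span_family G) a.2

/-- The norm of `C⋆(G)` dominates every unitary representation of `G`, whatever the universe of its
Hilbert space: `‖∑ c_g σ(g) v‖` is computed in the cyclic subspace of `v`, which is among the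
representations that define the norm. -/
theorem norm_linearCombination_le {G : Type u} [Group G] {K : Type*} [NormedAddCommGroup K]
    [InnerProductSpace ℂ K] [CompleteSpace K] (σ : G →* unitary (K →L[ℂ] K)) (c : G →₀ ℂ) :
    ‖Finsupp.linearCombination ℂ (fun g => (σ g : K →L[ℂ] K)) c‖ ≤
      ‖Finsupp.linearCombination ℂ (fun g => (iG G g : GroupCStarAlgebra G)) c‖ := by
  refine ContinuousLinearMap.opNorm_le_bound _ (norm_nonneg _) fun v => ?_
  obtain rfl | hv := eq_or_ne v 0
  · simp
  obtain ⟨π, J, ⟨w, rfl⟩, hJ⟩ := exists_unitaryRep_isometry σ v hv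
  have h : Finsupp.linearCombination ℂ (fun g => (σ g : K →L[ℂ] K)) c (J w) =
      J (evalCLM π (Finsupp.linearCombination ℂ (fun g => (iG G g : GroupCStarAlgebra G)) c) w) := by
    simp [Finsupp.linearCombination_apply, Finsupp.sum, hJ]
  rw [h, J.norm_map, J.norm_map]
  exact (ContinuousLinearMap.le_opNorm _ _).trans
    (mul_le_mul_of_nonneg_right (norm_evalCLM_apply_le π _) (norm_nonneg w))

/-- A group homomorphism `f : G → Γ` induces a ⋆-homomorphism `C⋆(G) → C⋆(Γ)`: a representation of
`Γ` pulls back along `f` to one of `G`. -/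
theorem exists_map {G : Type u} {Γ : Type*} [Group G] [Group Γ] (f : G →* Γ) :
    ∃ φ : GroupCStarAlgebra G →⋆ₐ[ℂ] GroupCStarAlgebra Γ,
      ∀ g, φ (iG G g : GroupCStarAlgebra G) = (iG Γ (f g) : GroupCStarAlgebra Γ) := by
  refine StarAlgHom.exists_of_norm_linearCombination_le (dense_span_range_iG G) ((iG Γ).comp f)
    fun c => norm_le_of_forall_evalCLM_le (norm_nonneg _) fun σ => ?_
  refine le_trans (le_of_eq ?_) (norm_linearCombination_le (σ.rep.comp f) c)
  exact congrArg norm (ContinuousLinearMap.map_linearCombination (evalCLM σ)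
    (fun g => (iG Γ (f g) : GroupCStarAlgebra Γ)) c)

end GroupCStarAlgebra

/-! ### Representations of a semidirect product induced from the normal factor -/

section Induced

variable {G H : Type*} [Group G] [Group H] (α : H →* MulAut G) {K : Type*}
  [NormedAddCommGroup K] [InnerProductSpace ℂ K] [CompleteSpace K]
  (π : G →* unitary (K →L[ℂ] K))

/-- The square norms of the coordinates of the translate of `f` are a permutation of those of `f`. -/
theorem hasSum_norm_twistedTranslate (γ : G ⋊[α] H) (f : lp (fun _ : H => K) 2) :
    HasSum (fun k => ‖(π (α k⁻¹ γ.left) : K →L[ℂ] K) (f (γ.right⁻¹ * k))‖ ^ (2 : ℝ≥0∞).toReal)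
      (‖f‖ ^ (2 : ℝ≥0∞).toReal) := by
  simp_rw [norm_unitary_apply]
  have h := lp.hasSum_norm (p := 2) (by norm_num) f
  exact (Equiv.mulLeft γ.right⁻¹).hasSum_iff.mpr h

/-- The action of `γ = (g, h)` on `ℓ²(H, K)` induced from a representation `π` of `G` on `K`:
`(γ f)(k) = π(α_{k⁻¹}(g)) f(h⁻¹ k)`. -/
def twistedTranslate (γ : G ⋊[α] H) (f : lp (fun _ : H => K) 2) : lp (fun _ : H => K) 2 :=
  ⟨fun k => (π (α k⁻¹ γ.left) : K →L[ℂ] K) (f (γ.right⁻¹ * k)),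
    memℓp_gen (hasSum_norm_twistedTranslate α π γ f).summable⟩

theorem norm_twistedTranslate (γ : G ⋊[α] H) (f : lp (fun _ : H => K) 2) :
    ‖twistedTranslate α π γ f‖ = ‖f‖ := by
  have h0 : 0 < (2 : ℝ≥0∞).toReal := by norm_num
  have h1 : ‖twistedTranslate α π γ f‖ ^ (2 : ℝ≥0∞).toReal = ‖f‖ ^ (2 : ℝ≥0∞).toReal :=
    (lp.hasSum_norm h0 (twistedTranslate α π γ f)).unique (hasSum_norm_twistedTranslate α π γ f)
  exact (Real.rpow_left_inj (norm_nonneg _) (norm_nonneg _) h0.ne').mp h1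

/-- The action `twistedTranslate` of one element of `G ⋊[α] H`, as a linear isometry. -/
def inducedIsometry (γ : G ⋊[α] H) : lp (fun _ : H => K) 2 →ₗᵢ[ℂ] lp (fun _ : H => K) 2 where
  toFun := twistedTranslate α π γ
  map_add' _ _ := lp.ext (funext fun _ => map_add _ _ _)
  map_smul' _ _ := lp.ext (funext fun _ => map_smul _ _ _)
  norm_map' := norm_twistedTranslate α π γ

theorem inducedIsometry_apply (γ : G ⋊[α] H) (f : lp (fun _ : H => K) 2) (k : H) :
    inducedIsometry α π γ f k = (π (α k⁻¹ γ.left) : K →L[ℂ] K) (f (γ.right⁻¹ * k)) := rfl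

/-- The representation of `G ⋊[α] H` on `ℓ²(H, K)` induced from the representation `π` of `G`. -/
def inducedHom : G ⋊[α] H →* unitary (lp (fun _ : H => K) 2 →L[ℂ] lp (fun _ : H => K) 2) :=
  let F : G ⋊[α] H →* (lp (fun _ : H => K) 2 →L[ℂ] lp (fun _ : H => K) 2) :=
    { toFun γ := (inducedIsometry α π γ).toContinuousLinearMap
      map_one' := by
        ext f k
        simp [inducedIsometry_apply]
      map_mul' γ δ := by
        ext f k
        simp [inducedIsometry_apply, mul_assoc] }
  F.codRestrict (unitary _) (F.mem_unitary_of_norm_map fun γ => (inducedIsometry α π γ).norm_map)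

end Induced

open GroupCStarAlgebra in
/-- Let `ρ` be induced from `π`. The coordinate at `1 : H` of `ℓ²(H, π.space)` spans a copy of `π` in
the restriction of `ρ` to `G`, so `ρ(ι a)` determines `π(a)`. -/
theorem injective_of_map_iG_semidirectProduct {G H : Type*} [Group G] [Group H] (α : H →* MulAut G)
    (ι : GroupCStarAlgebra G →⋆ₐ[ℂ] GroupCStarAlgebra (G ⋊[α] H))
    (hι : ∀ g : G, ι (iG G g : GroupCStarAlgebra G) =
      (iG (G ⋊[α] H) (⟨g, 1⟩ : G ⋊[α] H) : GroupCStarAlgebra (G ⋊[α] H))) :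
    Function.Injective ι := by
  classical
  rw [injective_iff_map_eq_zero]
  intro a ha
  refine ext_evalCLM fun π => ?_
  ext v
  let δ : π.space →L[ℂ] lp (fun _ : H => π.space) 2 :=
    lp.singleContinuousLinearMap ℂ (fun _ : H => π.space) 2 1
  have hδ (v : π.space) : δ v 1 = v := lp.single_apply_self (E := fun _ : H => π.space) 2 1 v
  have : Nontrivial (lp (fun _ : H => π.space) 2) :=
    Function.Injective.nontrivial (f := δ) fun v w h => by rw [← hδ v, h, hδ]
  let ρ : UnitaryRep (G ⋊[α] H) := ⟨lp (fun _ : H => π.space) 2, inducedHom α π.rep⟩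
  let ev := lp.evalCLM ℂ (fun _ : H => π.space) 2 1
  let S : GroupCStarAlgebra (G ⋊[α] H) →L[ℂ] π.space :=
    ev ∘L (ContinuousLinearMap.apply ℂ _ (δ v)) ∘L evalCLM ρ
  have h := StarAlgHom.apply_eq_of_dense_span_unitary (dense_span_range_iG G) ι S
    (ContinuousLinearMap.apply ℂ _ v ∘L evalCLM π) (fun g => by
      rw [hι]
      -- `ρ(g, 1)` multiplies the coordinate at `1` by `π(α_1(g)) = π(g)`.
      change (π.rep (α 1⁻¹ g) : π.space →L[ℂ] π.space) (δ v (1⁻¹ * 1)) =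
        (π.rep g : π.space →L[ℂ] π.space) v
      simp [hδ]) a
  change evalCLM π a v = 0
  rw [ha, map_zero] at h
  exact h.symm

end

open GroupCStarAlgebra in
theorem mainTheorem11 {G H : Type*} [Group G] [Group H] (α : H →* MulAut G) :
    ∃ ι : GroupCStarAlgebra G →⋆ₐ[ℂ] GroupCStarAlgebra (G ⋊[α] H),
      (∀ g : G, ι (iG G g : GroupCStarAlgebra G) =
        (iG (G ⋊[α] H) (⟨g, 1⟩ : G ⋊[α] H) : GroupCStarAlgebra (G ⋊[α] H))) ∧
      (IsAmenableGroup G →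
        Function.Injective ι ∧
        ∃ S : StarSubalgebra ℂ (GroupCStarAlgebra (G ⋊[α] H)),
          (S : Set (GroupCStarAlgebra (G ⋊[α] H))) =
            closure (Submodule.span ℂ (Set.range fun g : G =>
              (iG (G ⋊[α] H) (⟨g, 1⟩ : G ⋊[α] H) : GroupCStarAlgebra (G ⋊[α] H))) :
                Set (GroupCStarAlgebra (G ⋊[α] H))) ∧
          ∃ e : GroupCStarAlgebra G ≃⋆ₐ[ℂ] S,
            ∀ a : GroupCStarAlgebra G, (e a : GroupCStarAlgebra (G ⋊[α] H)) = ι a) := by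
  obtain ⟨ι, hι⟩ := exists_map (SemidirectProduct.inl : G →* G ⋊[α] H)
  have hinj := injective_of_map_iG_semidirectProduct α ι hι
  refine ⟨ι, hι, fun _ => ⟨hinj, ι.range, ?_, StarAlgEquiv.ofInjective ι hinj, fun _ => rfl⟩⟩
  rw [StarAlgHom.coe_range_eq_closure_span (dense_span_range_iG G) ι hinj]
  simp_rw [hι]
  rfl
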